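/- Let $k$ be a field of characteristic different from $2$ and $3$, with algebraic closure $\bar k$, and let $S\in k[t]$ be a polynomial of degree $5$ or $6$ without repeated roots in $\bar k$. Let $\mathcal E$ be the elliptic curve $y^2=x^3+S(t)$ over $\bar k(t)$. For $f\in\bar k(t)$ let $\deg f$ be its degree as a rational map to $\mathbf P^1$ (the maximum of the degrees of numerator and denominator in lowest terms), and define the naive height $h$ on $\mathcal E(\bar k(t))$ by $h(0)=0$ and $h((x,y))=\max(\deg x,\tfrac23\deg y)$. The canonical height $\hat h(P)=\lim_{n\to\infty}4^{-n}h(2^nP)$ is the unique real-valued quadratic form on the group $\mathcal E(\bar k(t))$ for which $\hat h-h$ is bounded. Then: (i) for every $P\in\mathcal E(\bar k(t))$, $\hat h(P)$ is an even integer, and $\hat h(P)>0$ unless $P=0$; (ii) the points $P$ with $\hat h(P)=2$ are exactly the points $(x,y)$ given by the minimal solutions of $y^2=x^3+S$, that is, by polynomials $x,y\in\bar k[t]$ with $\deg x\le 2$, $\deg y\le 3$ and $y^2=x^3+S$; (iii) the torsion subgroup of $\mathcal E(\bar k(t))$ is trivial. -/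

import Mathlib

open Polynomial

namespace SexticSurface

/-- Equality of rational functions is decided classically; Mathlib's group law on the points of a
Weierstrass curve asks for such an instance. -/
noncomputable instance ratFuncDecidableEq (K : Type*) [Field K] : DecidableEq (RatFunc K) :=
  Classical.decEq _

/-- The curve `y² = x³ + S(t)` over the rational function field `K(t)`. -/
noncomputable def curve {K : Type*} [Field K] (S : K[X]) : WeierstrassCurve.Affine (RatFunc K) where
  a₁ := 0
  a₂ := 0
  a₃ := 0
  a₄ := 0
  a₆ := algebraMap K[X] (RatFunc K) S

/-- The degree of a rational function regarded as a rational map from the `t`-line to `ℙ¹`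
(constants have degree `0`). `num` and `denom` are coprime. -/
noncomputable def ratDegree {K : Type*} [Field K] (f : RatFunc K) : ℕ :=
  max f.num.natDegree f.denom.natDegree

/-- The naive height: `0` at the zero point and `max (deg x, (2/3) deg y)` at `(x, y)`. -/
noncomputable def naiveHeight {K : Type*} [Field K] {S : K[X]} : (curve S).Point → ℝ
  | .zero => 0
  | .some x y _ => max (ratDegree x : ℝ) (2 / 3 * (ratDegree y : ℝ))

/-- The two properties that characterize the canonical (Néron–Tate) height: it is a quadratic form
on the group of points, and it differs from the naive height by a bounded amount. -/
structure IsCanonicalHeight {K : Type*} [Field K] {S : K[X]} (g : (curve S).Point → ℝ) : Prop where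
  quadratic : ∃ Q : QuadraticMap ℤ (curve S).Point ℝ, ∀ P, Q P = g P
  bounded : ∃ C : ℝ, ∀ P, |g P - naiveHeight P| ≤ C

/-- The canonical height, as Tate's limit of `h(2ⁿ P) / 4ⁿ`. -/
noncomputable def canonicalHeight {K : Type*} [Field K] {S : K[X]} (P : (curve S).Point) : ℝ :=
  Filter.limUnder Filter.atTop fun n : ℕ => naiveHeight ((2 ^ n : ℕ) • P) / 4 ^ n

/-- A minimal solution of `y² = x³ + S`: polynomials of degree at most `2` and `3`. -/
structure IsMinimalSolution {K : Type*} [Field K] (S x y : K[X]) : Prop where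
  degree_x : x.natDegree ≤ 2
  degree_y : y.natDegree ≤ 3
  equation : y ^ 2 = x ^ 3 + S

end SexticSurface

/-!
For a point `P` with `x(P) = p / q` in lowest terms, put `N(P) = max (deg p, deg q + 2)`: this is
the degree of the map `(p : q)` when `x` is regarded as a section of a line bundle of degree `2`, as
it is on the minimal model of the elliptic surface. The pair `x(P + Q)`, `x(P - Q)` is given by
quadratic forms in the symmetric functions of `x(P)`, `x(Q)`. As `S` is squarefree of degree `5` or
`6`, the surface is regular along every fibre, including the one at infinity, so no section meets
the singular point of a fibre; hence the quadratic forms have no common zero on the `t`-line, no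
cancellation takes place, and comparing degrees shows that `N` satisfies the parallelogram law
exactly. So `N` is a quadratic form at bounded distance from `h`, that is, `N` is the canonical
height. It is even because `(deg q, deg (denominator of y))` is proportional to `(2, 3)`, it is at
least `2` at `P ≠ 0`, and it is `2` exactly when `q = 1` and `deg p ≤ 2`.
-/

namespace SexticSurface

/-! ### Unimodular families -/

section Unimodular

universe u

variable {ι : Type*}

/-- The members of a family in a commutative ring generate the unit ideal; for polynomials over a
field, they have no common zero over an algebraic closure. -/
def IsUnimodular {R : Type*} [CommRing R] (W : ι → R) : Prop :=
  Ideal.span (Set.range W) = ⊤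

theorem IsUnimodular.comp_ringHom_ne_zero {R R' : Type*} [CommRing R] [CommRing R'] [Nontrivial R']
    {W : ι → R} (hW : IsUnimodular W) (φ : R →+* R') : φ ∘ W ≠ 0 := by
  intro h
  have hker : Ideal.span (Set.range W) ≤ RingHom.ker φ :=
    Ideal.span_le.2 (Set.range_subset_iff.2 (congrFun h))
  exact RingHom.ker_ne_top φ (top_le_iff.1 (hW.symm.trans_le hker))

theorem isUnimodular_of_forall_field {R : Type u} [CommRing R] {W : ι → R}
    (hW : ∀ (F : Type u) [Field F] (φ : R →+* F), φ ∘ W ≠ 0) : IsUnimodular W := by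
  by_contra h
  obtain ⟨M, hM, hle⟩ := Ideal.exists_le_maximal _ h
  let _ := Ideal.Quotient.field M
  refine hW (R ⧸ M) (Ideal.Quotient.mk M) (funext fun i => ?_)
  exact Ideal.Quotient.eq_zero_iff_mem.2 (hle (Ideal.subset_span ⟨i, rfl⟩))

theorem isUnimodular_of_isCoprime {R : Type*} [CommRing R] {p : Fin 2 → R}
    (hp : IsCoprime (p 0) (p 1)) : IsUnimodular p := by
  obtain ⟨a, b, hab⟩ := hp
  refine (Ideal.eq_top_iff_one _).2 (hab ▸ add_mem ?_ ?_) <;>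
    exact Ideal.mul_mem_left _ _ (Ideal.subset_span ⟨_, rfl⟩)

theorem IsUnimodular.exists_eq_smul {R : Type*} [CommRing R] {W T : ι → R} (hW : IsUnimodular W)
    (h : ∀ i j, W i * T j = W j * T i) : ∃ c : R, T = c • W := by
  suffices H : ∀ r ∈ Ideal.span (Set.range W), ∃ c : R, r • T = c • W by
    simpa only [one_smul] using H 1 (hW ▸ Submodule.mem_top)
  intro r hr
  induction hr using Submodule.span_induction with
  | mem r hr =>
    obtain ⟨i, rfl⟩ := hr
    exact ⟨T i, funext fun j => (h i j).trans (mul_comm _ _)⟩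
  | zero => exact ⟨0, by simp only [zero_smul]⟩
  | add r r' _ _ ih ih' =>
    obtain ⟨⟨c, hc⟩, c', hc'⟩ := ih, ih'
    exact ⟨c + c', by rw [add_smul, add_smul, hc, hc']⟩
  | smul a r _ ih =>
    obtain ⟨c, hc⟩ := ih
    exact ⟨a * c, by rw [smul_eq_mul, mul_smul, mul_smul, hc]⟩

theorem IsUnimodular.exists_isUnit_eq_smul {R : Type*} [CommRing R] {W T : ι → R}
    (hW : IsUnimodular W) (hT : IsUnimodular T) (h : ∀ i j, W i * T j = W j * T i) :
    ∃ c : R, IsUnit c ∧ T = c • W := by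
  obtain ⟨c, rfl⟩ := hW.exists_eq_smul h
  refine ⟨c, Ideal.span_singleton_eq_top.1 (top_le_iff.1 (hT.symm.trans_le ?_)), rfl⟩
  rw [Ideal.span_le, Set.range_subset_iff]
  exact fun i => Ideal.mem_span_singleton.2 (Dvd.intro _ rfl)

theorem mul_eq_mul_of_comp_eq_smul {R R' : Type*} [CommRing R] [CommRing R'] {φ : R →+* R'}
    (hφ : Function.Injective φ) {W T : ι → R} {v : ι → R'} {a b : R'} (hW : φ ∘ W = a • v)
    (hT : φ ∘ T = b • v) (i j : ι) : W i * T j = W j * T i := by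
  have hWv (i : ι) : φ (W i) = a * v i := congrFun hW i
  have hTv (i : ι) : φ (T i) = b * v i := congrFun hT i
  apply hφ
  rw [map_mul, map_mul, hWv, hTv, hWv, hTv]
  ring

end Unimodular

/-! ### Weighted degrees and top coefficients -/

section WeightedDegree

/-- `p` has degree at most `n`, and its coefficient in degree `n` is `a`; that is, `a` is the value
at infinity of `p` regarded as a form of degree `n`. -/
def HasTopCoeff {R : Type*} [Semiring R] (p : R[X]) (n : ℕ) (a : R) : Prop :=
  p.natDegree ≤ n ∧ p.coeff n = a

namespace HasTopCoeff

variable {R : Type*} [Semiring R] {p q : R[X]} {m n : ℕ} {a b : R}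

theorem mul (hp : HasTopCoeff p m a) (hq : HasTopCoeff q n b) :
    HasTopCoeff (p * q) (m + n) (a * b) :=
  ⟨natDegree_mul_le_of_le hp.1 hq.1, by rw [coeff_mul_add_eq_of_natDegree_le hp.1 hq.1, hp.2, hq.2]⟩

theorem sq (hp : HasTopCoeff p m a) : HasTopCoeff (p ^ 2) (m + m) (a ^ 2) := by
  simpa only [pow_two] using hp.mul hp

theorem add (hp : HasTopCoeff p m a) (hq : HasTopCoeff q m b) : HasTopCoeff (p + q) m (a + b) :=
  ⟨natDegree_add_le_of_degree_le hp.1 hq.1, by rw [coeff_add, hp.2, hq.2]⟩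

theorem sub {R : Type*} [Ring R] {p q : R[X]} {a b : R} (hp : HasTopCoeff p m a)
    (hq : HasTopCoeff q m b) : HasTopCoeff (p - q) m (a - b) :=
  ⟨natDegree_sub_le_of_le hp.1 hq.1 |>.trans (max_self m).le, by rw [coeff_sub, hp.2, hq.2]⟩

theorem C_mul (c : R) (hp : HasTopCoeff p m a) : HasTopCoeff (C c * p) m (c * a) :=
  ⟨(natDegree_C_mul_le _ _).trans hp.1, by rw [coeff_C_mul, hp.2]⟩

theorem X_pow_mul (hp : HasTopCoeff p n a) (k : ℕ) : HasTopCoeff (X ^ k * p) (n + k) a :=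
  ⟨(natDegree_mul_le_of_le (natDegree_X_pow_le k) hp.1).trans_eq (add_comm k n), by
    rw [coeff_X_pow_mul, hp.2]⟩

theorem of_X_pow_mul {k : ℕ} (hp : HasTopCoeff (X ^ k * p) (n + k) a) : HasTopCoeff p n a := by
  refine ⟨natDegree_le_iff_coeff_eq_zero.2 fun m hm => ?_, by rw [← hp.2, coeff_X_pow_mul]⟩
  rw [← coeff_X_pow_mul p k m]
  exact natDegree_le_iff_coeff_eq_zero.1 hp.1 _ (by omega)

theorem natDegree_eq (hp : HasTopCoeff p n a) (ha : a ≠ 0) : p.natDegree = n :=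
  le_antisymm hp.1 (le_natDegree_of_ne_zero (hp.2.trans_ne ha))

end HasTopCoeff

variable {n : ℕ}

/-- Multiplication of the `i`-th member of a family of polynomials by `X ^ (2 * i)`. If the family
consists of homogeneous coordinates on the projective line, the `i`-th one having weight `2 * i`,
this makes all of them have weight `0` at infinity. -/
noncomputable def twist {R : Type*} [Semiring R] (W : Fin n → R[X]) : Fin n → R[X] :=
  fun i => X ^ (2 * (i : ℕ)) * W i

/-- The degree of a family of polynomials regarded as homogeneous coordinates on the projective
line, the `i`-th one having weight `2 * i`. -/
noncomputable def weightedDegree {R : Type*} [Semiring R] (W : Fin n → R[X]) : ℕ :=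
  Finset.univ.sup fun i => (twist W i).natDegree

theorem natDegree_twist_le_weightedDegree {R : Type*} [Semiring R] (W : Fin n → R[X]) (i : Fin n) :
    (twist W i).natDegree ≤ weightedDegree W :=
  Finset.le_sup (f := fun i => (twist W i).natDegree) (Finset.mem_univ i)

theorem weightedDegree_eq_of_hasTopCoeff {R : Type*} [Semiring R] {W : Fin n → R[X]} {N : ℕ}
    {a : Fin n → R} (hW : ∀ i, HasTopCoeff (twist W i) N (a i)) (ha : a ≠ 0) :
    weightedDegree W = N := by
  obtain ⟨i, hi⟩ : ∃ i, a i ≠ 0 := Function.ne_iff.1 ha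
  exact le_antisymm (Finset.sup_le fun i _ => (hW i).1)
    ((hW i).natDegree_eq hi ▸ natDegree_twist_le_weightedDegree W i)

theorem exists_hasTopCoeff_weightedDegree {R : Type*} [Semiring R] {W : Fin n → R[X]}
    (hW : W ≠ 0) :
    ∃ a : Fin n → R, a ≠ 0 ∧ ∀ i, HasTopCoeff (twist W i) (weightedDegree W) (a i) := by
  refine ⟨fun i => (twist W i).coeff (weightedDegree W), fun h0 => ?_,
    fun i => ⟨natDegree_twist_le_weightedDegree W i, rfl⟩⟩
  have hlt (i : Fin n) (hi : W i ≠ 0) : (twist W i).natDegree < weightedDegree W := by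
    refine (natDegree_twist_le_weightedDegree W i).lt_of_ne fun heq => hi ?_
    have hlead : (twist W i).leadingCoeff = 0 := by
      rw [leadingCoeff, heq]
      exact congrFun h0 i
    rwa [twist, X_pow_mul, leadingCoeff_mul_X_pow, leadingCoeff_eq_zero] at hlead
  obtain ⟨i₀, hi₀⟩ := Function.ne_iff.1 hW
  have hpos : 0 < weightedDegree W := (Nat.zero_le _).trans_lt (hlt i₀ hi₀)
  refine ((Finset.sup_lt_iff hpos).2 fun i _ => ?_ : weightedDegree W < _).ne rfl
  by_cases hi : W i = 0
  · simpa only [twist, hi, mul_zero, natDegree_zero] using hpos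
  · exact hlt i hi

theorem weightedDegree_smul_of_isUnit {R : Type*} [CommRing R] [IsDomain R] {c : R[X]}
    (hc : IsUnit c) (W : Fin n → R[X]) : weightedDegree (c • W) = weightedDegree W := by
  refine Finset.sup_congr rfl fun i _ => natDegree_eq_of_degree_eq ?_
  refine degree_eq_degree_of_associated ?_
  rw [twist, Pi.smul_apply, smul_eq_mul, mul_left_comm]
  exact associated_unit_mul_left _ c hc

theorem IsUnimodular.weightedDegree_eq {R : Type*} [CommRing R] [IsDomain R] {W T : Fin n → R[X]}
    (hW : IsUnimodular W) (hT : IsUnimodular T) (h : ∀ i j, W i * T j = W j * T i) :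
    weightedDegree W = weightedDegree T := by
  obtain ⟨c, hc, rfl⟩ := hW.exists_isUnit_eq_smul hT h
  exact (weightedDegree_smul_of_isUnit hc W).symm

end WeightedDegree

/-! ### The sum and the difference of two points -/

section AddSubForms

/-- The elementary symmetric functions of two points `(p 0 : p 1)` and `(q 0 : q 1)` of the
projective line; for the `x`-coordinates of two points of a Weierstrass curve, this is
`WeierstrassCurve.Affine.Point.sym2x`. -/
def symProd {R : Type*} [CommRing R] (p q : Fin 2 → R) : Fin 3 → R :=
  ![p 0 * q 0, p 0 * q 1 + p 1 * q 0, p 1 * q 1]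

/-- The values at `v` of the quadratic forms `WeierstrassCurve.addSubMap`, which express the
symmetric functions of `x(P + Q)` and `x(P - Q)` in terms of those of `x(P)` and `x(Q)`. -/
noncomputable def addSubForms {R : Type*} [CommRing R] (W : WeierstrassCurve R) (v : Fin 3 → R) :
    Fin 3 → R :=
  fun i => (W.addSubMap i).eval v

section CommRing

variable {R R' : Type*} [CommRing R] [CommRing R']

theorem symProd_smul_smul (a b : R) (p q : Fin 2 → R) :
    symProd (a • p) (b • q) = (a * b) • symProd p q := by
  ext i
  fin_cases i <;> simp [symProd] <;> ring

theorem comp_symProd (φ : R →+* R') (p q : Fin 2 → R) :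
    φ ∘ symProd p q = symProd (φ ∘ p) (φ ∘ q) := by
  ext i
  fin_cases i <;> simp [symProd]

theorem addSubForms_eq (W : WeierstrassCurve R) (v : Fin 3 → R) :
    addSubForms W v =
      ![v 0 ^ 2 - W.b₄ * v 0 * v 2 - W.b₆ * v 1 * v 2 - W.b₈ * v 2 ^ 2,
        2 * v 1 * v 0 + W.b₂ * v 0 * v 2 + W.b₄ * v 1 * v 2 + W.b₆ * v 2 ^ 2,
        v 1 ^ 2 - 4 * v 0 * v 2] := by
  ext i
  fin_cases i <;> simp [addSubForms, WeierstrassCurve.addSubMap]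

theorem addSubForms_smul (W : WeierstrassCurve R) (c : R) (v : Fin 3 → R) :
    addSubForms W (c • v) = c ^ 2 • addSubForms W v := by
  ext i
  fin_cases i <;> simp [addSubForms_eq] <;> ring

theorem comp_addSubForms (φ : R →+* R') (W : WeierstrassCurve R) (v : Fin 3 → R) :
    φ ∘ addSubForms W v = addSubForms (W.map φ) (φ ∘ v) := by
  ext i
  fin_cases i <;> simp [addSubForms_eq, map_ofNat φ]

end CommRing

end AddSubForms

section GroupLaw

open WeierstrassCurve.Affine

section CommRing

variable {R : Type*} [CommRing R] {E : WeierstrassCurve.Affine R} {x₁ x₂ y₁ y₂ : R}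

theorem addSubForms_sym2x_zero (P : E.Point) : addSubForms E (P.sym2x 0) = P.sym2x P := by
  rw [addSubForms_eq]
  ext i
  rcases P with _ | ⟨x, y, h⟩
  · fin_cases i <;> simp [← Point.zero_def]
  · fin_cases i <;> simp [sq, two_mul]

theorem sq_sub_negY_eq_of_equation {x y : R} (h : E.Equation x y) :
    (y - E.negY x y) ^ 2 = 4 * x ^ 3 + E.b₂ * x ^ 2 + 2 * E.b₄ * x + E.b₆ := by
  rw [equation_iff] at h
  simp only [negY, WeierstrassCurve.b₂, WeierstrassCurve.b₄, WeierstrassCurve.b₆]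
  linear_combination 4 * h

theorem addSubForms_self_of_equation {x y : R} (h : E.Equation x y) :
    addSubForms E ![x * x, x + x, 1] =
      ![x ^ 4 - E.b₄ * x ^ 2 - 2 * E.b₆ * x - E.b₈, (y - E.negY x y) ^ 2, 0] := by
  rw [sq_sub_negY_eq_of_equation h, addSubForms_eq]
  ext i
  fin_cases i <;> simp <;> ring

theorem sq_mul_addX {ℓ m : R} (hℓ : ℓ * (x₁ - x₂) = m) :
    (x₁ - x₂) ^ 2 * E.addX x₁ x₂ ℓ =
      m ^ 2 + E.a₁ * (x₁ - x₂) * m - (E.a₂ + x₁ + x₂) * (x₁ - x₂) ^ 2 := by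
  subst hℓ
  simp only [addX]
  ring

variable {ℓ ℓ' : R}

theorem sq_mul_addX_add_addX (h₁ : E.Equation x₁ y₁) (h₂ : E.Equation x₂ y₂)
    (hℓ : ℓ * (x₁ - x₂) = y₁ - y₂) (hℓ' : ℓ' * (x₁ - x₂) = y₁ - E.negY x₂ y₂) :
    (x₁ - x₂) ^ 2 * (E.addX x₁ x₂ ℓ + E.addX x₁ x₂ ℓ') =
      2 * (x₁ + x₂) * (x₁ * x₂) + E.b₂ * (x₁ * x₂) + E.b₄ * (x₁ + x₂) + E.b₆ := by
  rw [equation_iff] at h₁ h₂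
  rw [mul_add, sq_mul_addX hℓ, sq_mul_addX hℓ']
  simp only [negY, WeierstrassCurve.b₂, WeierstrassCurve.b₄, WeierstrassCurve.b₆]
  linear_combination 2 * h₁ + 2 * h₂

theorem sq_mul_addX_mul_addX [IsDomain R] (h₁ : E.Equation x₁ y₁) (h₂ : E.Equation x₂ y₂)
    (hx : x₁ ≠ x₂) (hℓ : ℓ * (x₁ - x₂) = y₁ - y₂) (hℓ' : ℓ' * (x₁ - x₂) = y₁ - E.negY x₂ y₂) :
    (x₁ - x₂) ^ 2 * (E.addX x₁ x₂ ℓ * E.addX x₁ x₂ ℓ') =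
      (x₁ * x₂) ^ 2 - E.b₄ * (x₁ * x₂) - E.b₆ * (x₁ + x₂) - E.b₈ := by
  rw [equation_iff] at h₁ h₂
  refine mul_left_cancel₀ (pow_ne_zero 2 (sub_ne_zero.2 hx)) ?_
  rw [mul_left_comm (_ ^ 2) (E.addX x₁ x₂ ℓ), ← mul_assoc, sq_mul_addX hℓ, sq_mul_addX hℓ']
  simp only [negY, WeierstrassCurve.b₄, WeierstrassCurve.b₆, WeierstrassCurve.b₈]
  -- The coefficients come from eliminating `y₁ ^ 2` and `y₂ ^ 2` with the Weierstrass equation.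
  linear_combination
    (y₁ ^ 2 + (E.a₁ * x₁ + E.a₃) * y₁ + (x₁ ^ 3 + E.a₂ * x₁ ^ 2 + E.a₄ * x₁ + E.a₆)
      + (y₂ ^ 2 + (E.a₁ * x₂ + E.a₃) * y₂) + (x₂ ^ 3 + E.a₂ * x₂ ^ 2 + E.a₄ * x₂ + E.a₆)
      + (E.a₁ * x₁ + E.a₃) * (E.a₁ * x₂ + E.a₃)
      - 2 * (E.a₂ + x₁ + x₂) * (x₁ - x₂) ^ 2) * (h₁ + h₂)
    - (2 * y₂ + E.a₁ * x₂ + E.a₃) ^ 2 * h₁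
    - ((E.a₁ * x₁ + E.a₃) ^ 2 + 4 * (x₁ ^ 3 + E.a₂ * x₁ ^ 2 + E.a₄ * x₁ + E.a₆)) * h₂

end CommRing

variable {F : Type*} [Field F] [DecidableEq F] {E : WeierstrassCurve.Affine F} {x y x₁ x₂ y₁ y₂ : F}

theorem sq_sub_negY_mul_addX_self (h : E.Equation x y) (hy : y ≠ E.negY x y) :
    (y - E.negY x y) ^ 2 * E.addX x x (E.slope x x y y) =
      x ^ 4 - E.b₄ * x ^ 2 - 2 * E.b₆ * x - E.b₈ := by
  rw [slope_of_Y_ne rfl hy, addX]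
  have hd := sub_ne_zero.2 hy
  rw [equation_iff] at h
  field_simp
  simp only [negY, WeierstrassCurve.b₄, WeierstrassCurve.b₆, WeierstrassCurve.b₈]
  linear_combination (- E.a₁ ^ 2 - 4 * (E.a₂ + 2 * x)) * h

theorem exists_addSubForms_sym2x_self_eq_smul (P : E.Point) :
    ∃ c : F, addSubForms E (P.sym2x P) = c • (P + P).sym2x 0 := by
  rcases P with _ | ⟨x, y, h⟩
  · exact ⟨1, by rw [← Point.zero_def, addSubForms_sym2x_zero, add_zero, one_smul]⟩
  rw [Point.sym2x_some_some, addSubForms_self_of_equation h.1]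
  by_cases hy : y = E.negY x y
  · rw [Point.add_self_of_Y_eq hy, Point.sym2x_zero_zero, sub_eq_zero.2 hy]
    exact ⟨x ^ 4 - E.b₄ * x ^ 2 - 2 * E.b₆ * x - E.b₈, by simp⟩
  · rw [Point.add_self_of_Y_ne hy, Point.sym2x_some_zero, ← sq_sub_negY_mul_addX_self h.1 hy]
    exact ⟨(y - E.negY x y) ^ 2, by simp⟩

theorem exists_addSubForms_sym2x_eq_smul_of_X_ne (h₁ : E.Nonsingular x₁ y₁)
    (h₂ : E.Nonsingular x₂ y₂) (hx : x₁ ≠ x₂) :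
    ∃ c : F, addSubForms E ((Point.some x₁ y₁ h₁).sym2x (.some x₂ y₂ h₂)) =
      c • (Point.some x₁ y₁ h₁ + .some x₂ y₂ h₂).sym2x (.some x₁ y₁ h₁ - .some x₂ y₂ h₂) := by
  have hd : x₁ - x₂ ≠ 0 := sub_ne_zero.2 hx
  have hℓ (y : F) : E.slope x₁ x₂ y₁ y * (x₁ - x₂) = y₁ - y := by
    rw [slope_of_X_ne hx, div_mul_cancel₀ _ hd]
  rw [sub_eq_add_neg, Point.neg_some, Point.add_of_X_ne hx, Point.add_of_X_ne hx,
    Point.sym2x_some_some, Point.sym2x_some_some, addSubForms_eq]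
  refine ⟨(x₁ - x₂) ^ 2, ?_⟩
  simp only [Matrix.smul_cons, smul_eq_mul, Matrix.smul_empty,
    sq_mul_addX_add_addX h₁.1 h₂.1 (hℓ _) (hℓ _), sq_mul_addX_mul_addX h₁.1 h₂.1 hx (hℓ _) (hℓ _)]
  ext i
  fin_cases i <;> simp
  ring

theorem exists_addSubForms_sym2x_eq_smul (P Q : E.Point) :
    ∃ c : F, addSubForms E (P.sym2x Q) = c • (P + Q).sym2x (P - Q) := by
  rcases P with _ | ⟨x₁, y₁, h₁⟩
  · rw [← Point.zero_def, zero_add, zero_sub, Point.sym2x_neg_right, Point.sym2x_comm]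
    exact ⟨1, by rw [one_smul, addSubForms_sym2x_zero]⟩
  rcases Q with _ | ⟨x₂, y₂, h₂⟩
  · rw [← Point.zero_def, add_zero, sub_zero]
    exact ⟨1, by rw [one_smul, addSubForms_sym2x_zero]⟩
  by_cases hx : x₁ = x₂
  · rcases (Point.X_eq_iff (h₁ := h₁) (h₂ := h₂)).1 hx with h | h
    · rw [← h, sub_self]
      exact exists_addSubForms_sym2x_self_eq_smul _
    · rw [← neg_eq_iff_eq_neg.2 h, Point.sym2x_neg_right, add_neg_cancel, sub_neg_eq_add,
        Point.sym2x_comm 0]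
      exact exists_addSubForms_sym2x_self_eq_smul _
  · exact exists_addSubForms_sym2x_eq_smul_of_X_ne h₁ h₂ hx

end GroupLaw

/-! ### The curve `y² = x³ + s` -/

section Mordell

/-- The Weierstrass curve `y² = x³ + s`. -/
def mordellCurve {R : Type*} [CommRing R] (s : R) : WeierstrassCurve R :=
  ⟨0, 0, 0, 0, s⟩

section CommRing

variable {R R' : Type*} [CommRing R] [CommRing R']

theorem mordellCurve_Δ (s : R) : (mordellCurve s).Δ = -(2 ^ 4 * 3 ^ 3 * s ^ 2) := by
  simp only [mordellCurve, WeierstrassCurve.Δ, WeierstrassCurve.b₂, WeierstrassCurve.b₄,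
    WeierstrassCurve.b₆, WeierstrassCurve.b₈]
  ring

theorem map_mordellCurve (φ : R →+* R') (s : R) :
    (mordellCurve s).map φ = mordellCurve (φ s) := by
  simp only [mordellCurve, WeierstrassCurve.map, map_zero]

theorem addSubForms_mordellCurve (s : R) (v : Fin 3 → R) :
    addSubForms (mordellCurve s) v =
      ![v 0 ^ 2 - 4 * (v 1 * v 2 * s), 2 * (v 1 * v 0) + 4 * (v 2 ^ 2 * s),
        v 1 ^ 2 - 4 * (v 0 * v 2)] := by
  rw [addSubForms_eq]
  ext i
  fin_cases i <;> simp [mordellCurve, WeierstrassCurve.b₂, WeierstrassCurve.b₄,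
    WeierstrassCurve.b₆, WeierstrassCurve.b₈] <;> ring

end CommRing

theorem symProd_ne_zero {R : Type*} [CommRing R] [IsDomain R] {p q : Fin 2 → R} (hp : p ≠ 0)
    (hq : q ≠ 0) : symProd p q ≠ 0 := by
  intro h
  have h0 : p 0 * q 0 = 0 := congrFun h 0
  have h1 : p 0 * q 1 + p 1 * q 0 = 0 := congrFun h 1
  have h2 : p 1 * q 1 = 0 := congrFun h 2
  rw [ne_eq, funext_iff, Fin.forall_fin_two] at hp hq
  simp only [Pi.zero_apply] at hp hq
  rcases mul_eq_zero.1 h0 with h0 | h0 <;> simp_all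

theorem addSubForms_symProd_ne_zero {F : Type*} [Field F] (h2 : (2 : F) ≠ 0) (h3 : (3 : F) ≠ 0)
    {s : F} {p q : Fin 2 → F} (hp : p ≠ 0) (hq : q ≠ 0) (hs : p 0 = 0 → s ≠ 0) :
    addSubForms (mordellCurve s) (symProd p q) ≠ 0 := by
  by_cases hs0 : s = 0
  · have hp0 : p 0 ≠ 0 := fun h => hs h hs0
    intro h
    rw [addSubForms_mordellCurve, hs0] at h
    have h0 : p 0 * q 0 = 0 := by simpa [symProd] using congrFun h 0
    have h1 : p 0 * q 1 + p 1 * q 0 = 0 := by simpa [symProd, h0] using congrFun h 2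
    have hq0 : q 0 = 0 := (mul_eq_zero.1 h0).resolve_left hp0
    have hq1 : q 1 = 0 := by simpa [hq0, hp0] using h1
    exact hq (funext (Fin.forall_fin_two.2 ⟨hq0, hq1⟩))
  · have : (mordellCurve s).IsElliptic := ⟨by simp [mordellCurve_Δ, h2, h3, hs0]⟩
    exact WeierstrassCurve.addSubMap_ne_zero _ (symProd_ne_zero hp hq)

theorem IsUnimodular.symProd {R : Type*} [CommRing R] {p q : Fin 2 → R} (hp : IsUnimodular p)
    (hq : IsUnimodular q) : IsUnimodular (symProd p q) :=
  isUnimodular_of_forall_field fun F _ φ => by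
    rw [comp_symProd]
    exact symProd_ne_zero (hp.comp_ringHom_ne_zero φ) (hq.comp_ringHom_ne_zero φ)

theorem IsUnimodular.addSubForms_symProd {R : Type*} [CommRing R] (h2 : IsUnit (2 : R))
    (h3 : IsUnit (3 : R)) {s : R} {p q : Fin 2 → R} (hp : IsUnimodular p) (hq : IsUnimodular q)
    (hs : IsCoprime (p 0) s) :
    IsUnimodular (addSubForms (mordellCurve s) (SexticSurface.symProd p q)) := by
  refine isUnimodular_of_forall_field fun F _ φ => ?_
  rw [comp_addSubForms, map_mordellCurve, comp_symProd]
  refine addSubForms_symProd_ne_zero (map_ofNat φ 2 ▸ (h2.map φ).ne_zero)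
    (map_ofNat φ 3 ▸ (h3.map φ).ne_zero) (hp.comp_ringHom_ne_zero φ) (hq.comp_ringHom_ne_zero φ)
    fun h0 => ?_
  have := hs.map φ
  rw [show φ (p 0) = 0 from h0, isCoprime_zero_left] at this
  exact this.ne_zero

section TopCoeff

variable {R : Type*} [CommRing R] {S : R[X]}

theorem twist_symProd (p q : Fin 2 → R[X]) : twist (symProd p q) = symProd (twist p) (twist q) := by
  ext1 i
  fin_cases i <;> simp [twist, symProd] <;> ring

theorem X_pow_smul_twist_addSubForms (v : Fin 3 → R[X]) :
    (X ^ 6 : R[X]) • twist (addSubForms (mordellCurve S) v) =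
      ![X ^ 6 * twist v 0 ^ 2 - C 4 * (twist v 1 * twist v 2 * S),
        C 2 * (X ^ 6 * (twist v 1 * twist v 0)) + C 4 * (twist v 2 ^ 2 * S),
        X ^ 6 * (twist v 1 ^ 2 - C 4 * (twist v 0 * twist v 2))] := by
  rw [addSubForms_mordellCurve]
  ext1 i
  fin_cases i <;> simp [twist, map_ofNat C] <;> ring

theorem HasTopCoeff.symProd {p q : Fin 2 → R[X]} {M N : ℕ} {a b : Fin 2 → R}
    (hp : ∀ i, HasTopCoeff (p i) M (a i)) (hq : ∀ i, HasTopCoeff (q i) N (b i)) (i : Fin 3) :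
    HasTopCoeff (SexticSurface.symProd p q i) (M + N) (SexticSurface.symProd a b i) := by
  fin_cases i
  · exact (hp 0).mul (hq 0)
  · exact ((hp 0).mul (hq 1)).add ((hp 1).mul (hq 0))
  · exact (hp 1).mul (hq 1)

theorem HasTopCoeff.twist_addSubForms {v : Fin 3 → R[X]} {N : ℕ} {s : R} {a : Fin 3 → R}
    (hS : HasTopCoeff S 6 s) (hv : ∀ i, HasTopCoeff (twist v i) N (a i)) (i : Fin 3) :
    HasTopCoeff (twist (addSubForms (mordellCurve S) v) i) (N + N)
      (addSubForms (mordellCurve s) a i) := by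
  refine .of_X_pow_mul (k := 6) ?_
  rw [← smul_eq_mul, ← Pi.smul_apply, X_pow_smul_twist_addSubForms, addSubForms_mordellCurve]
  fin_cases i
  · exact ((hv 0).sq.X_pow_mul 6).sub ((((hv 1).mul (hv 2)).mul hS).C_mul 4)
  · exact ((((hv 1).mul (hv 0)).X_pow_mul 6).C_mul 2).add (((hv 2).sq.mul hS).C_mul 4)
  · exact ((hv 1).sq.sub (((hv 0).mul (hv 2)).C_mul 4)).X_pow_mul 6

end TopCoeff

variable {K : Type*} [Field K] {S : K[X]} {p q : Fin 2 → K[X]}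

theorem weightedDegree_symProd (hp : p ≠ 0) (hq : q ≠ 0) :
    weightedDegree (symProd p q) = weightedDegree p + weightedDegree q := by
  obtain ⟨a, ha, hpa⟩ := exists_hasTopCoeff_weightedDegree hp
  obtain ⟨b, hb, hqb⟩ := exists_hasTopCoeff_weightedDegree hq
  refine weightedDegree_eq_of_hasTopCoeff (fun i => ?_) (symProd_ne_zero ha hb)
  rw [twist_symProd]
  exact .symProd hpa hqb i

theorem weightedDegree_addSubForms_symProd (h2 : (2 : K) ≠ 0) (h3 : (3 : K) ≠ 0)
    (hS : S.natDegree ≤ 6) (hp : p ≠ 0) (hq : q ≠ 0)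
    (hinf : (p 0).coeff (weightedDegree p) = 0 → S.coeff 6 ≠ 0) :
    weightedDegree (addSubForms (mordellCurve S) (symProd p q)) =
      2 * (weightedDegree p + weightedDegree q) := by
  rw [two_mul]
  obtain ⟨a, ha, hpa⟩ := exists_hasTopCoeff_weightedDegree hp
  obtain ⟨b, hb, hqb⟩ := exists_hasTopCoeff_weightedDegree hq
  have ha0 : (p 0).coeff (weightedDegree p) = a 0 := by simpa [twist] using (hpa 0).2
  refine weightedDegree_eq_of_hasTopCoeff (HasTopCoeff.twist_addSubForms ⟨hS, rfl⟩ fun i => ?_)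
    (addSubForms_symProd_ne_zero h2 h3 ha hb fun h => hinf (ha0.trans h))
  rw [twist_symProd]
  exact .symProd hpa hqb i

end Mordell

/-! ### Points of `y² = x³ + S(t)` -/

section Points

variable {K : Type*} [Field K] {S : K[X]} {x y : RatFunc K}

theorem equation_curve_iff :
    (curve S).Equation x y ↔ y ^ 2 = x ^ 3 + algebraMap K[X] (RatFunc K) S := by
  rw [WeierstrassCurve.Affine.equation_iff]
  simp [curve]

theorem curve_Δ_ne_zero (h2 : (2 : K) ≠ 0) (h3 : (3 : K) ≠ 0) (hS : S ≠ 0) : (curve S).Δ ≠ 0 := by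
  have hS' : algebraMap K[X] (RatFunc K) S ≠ 0 := RatFunc.algebraMap_ne_zero hS
  have h2' : (2 : RatFunc K) ≠ 0 := by
    simpa only [map_ofNat] using (_root_.map_ne_zero (algebraMap K (RatFunc K))).2 h2
  have h3' : (3 : RatFunc K) ≠ 0 := by
    simpa only [map_ofNat] using (_root_.map_ne_zero (algebraMap K (RatFunc K))).2 h3
  exact (mordellCurve_Δ (algebraMap K[X] (RatFunc K) S)).trans_ne (by simp [h2', h3', hS'])

theorem num_denom_equation (h : (curve S).Equation x y) :
    y.num ^ 2 * x.denom ^ 3 = y.denom ^ 2 * (x.num ^ 3 + S * x.denom ^ 3) := by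
  have hx : algebraMap K[X] (RatFunc K) x.denom ≠ 0 := RatFunc.algebraMap_ne_zero x.denom_ne_zero
  have hy : algebraMap K[X] (RatFunc K) y.denom ≠ 0 := RatFunc.algebraMap_ne_zero y.denom_ne_zero
  rw [equation_curve_iff, ← RatFunc.num_div_denom x, ← RatFunc.num_div_denom y] at h
  apply RatFunc.algebraMap_injective K
  simp only [map_mul, map_pow, map_add]
  field_simp at h
  linear_combination h

theorem associated_denom_pow (h : (curve S).Equation x y) :
    Associated (y.denom ^ 2) (x.denom ^ 3) := by
  have hx : IsCoprime (x.num ^ 3 + S * x.denom ^ 3) (x.denom ^ 3) :=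
    (IsCoprime.pow x.isCoprime_num_denom).add_mul_right_left S
  have hy : IsCoprime (y.num ^ 2) (y.denom ^ 2) := IsCoprime.pow y.isCoprime_num_denom
  exact associated_of_dvd_dvd (hy.symm.dvd_of_dvd_mul_left ⟨_, num_denom_equation h⟩)
    (hx.symm.dvd_of_dvd_mul_right (Dvd.intro_left _ (num_denom_equation h)))

theorem associated_num_sq (h : (curve S).Equation x y) :
    Associated (y.num ^ 2) (x.num ^ 3 + S * x.denom ^ 3) := by
  refine .of_mul_right (.of_eq ?_) (associated_denom_pow h).symm (pow_ne_zero 3 x.denom_ne_zero)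
  rw [num_denom_equation h, mul_comm]

theorem two_mul_natDegree_denom (h : (curve S).Equation x y) :
    2 * y.denom.natDegree = 3 * x.denom.natDegree := by
  simpa only [natDegree_pow] using
    natDegree_eq_of_degree_eq (degree_eq_degree_of_associated (associated_denom_pow h))

theorem two_mul_natDegree_num (h : (curve S).Equation x y) :
    2 * y.num.natDegree = (x.num ^ 3 + S * x.denom ^ 3).natDegree := by
  simpa only [natDegree_pow] using
    natDegree_eq_of_degree_eq (degree_eq_degree_of_associated (associated_num_sq h))

theorem natDegree_mul_denom_pow_le (hS : S.natDegree ≤ 6) :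
    (S * x.denom ^ 3).natDegree ≤ 3 * (x.denom.natDegree + 2) :=
  (natDegree_mul_le_of_le hS natDegree_pow_le).trans_eq (by ring)

theorem two_mul_natDegree_num_le (hS : S.natDegree ≤ 6) (h : (curve S).Equation x y) :
    2 * y.num.natDegree ≤ 3 * max x.num.natDegree (x.denom.natDegree + 2) := by
  rw [two_mul_natDegree_num h, ← Nat.mul_max_mul_left]
  exact (natDegree_add_le _ _).trans
    (max_le_max natDegree_pow_le (natDegree_mul_denom_pow_le hS))

-- Geometrically: a section does not meet the singular point of a fibre `y² = x³` over the affine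
-- line, as such points are regular on the surface.
theorem isCoprime_num (hS : Squarefree S) (h : (curve S).Equation x y) : IsCoprime x.num S := by
  refine isCoprime_of_irreducible_dvd (fun h0 => hS.ne_zero h0.2) fun p hp hpx hpS => ?_
  have hpy : p ∣ y.num := by
    refine hp.prime.dvd_of_dvd_pow ((associated_num_sq h).dvd_iff_dvd_right.2 ?_)
    exact dvd_add (dvd_pow hpx three_ne_zero) (hpS.mul_right _)
  have hpd : IsCoprime (p ^ 2) (x.denom ^ 3) :=
    (x.isCoprime_num_denom.of_isCoprime_of_dvd_left hpx).pow
  have hsum : p ^ 2 ∣ x.num ^ 3 + S * x.denom ^ 3 :=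
    (pow_dvd_pow_of_dvd hpy 2).trans (associated_num_sq h).dvd
  have hpx3 : p ^ 2 ∣ x.num ^ 3 := (pow_dvd_pow_of_dvd hpx 2).trans (pow_dvd_pow _ (by norm_num))
  exact hp.not_isUnit (hS p (pow_two p ▸ hpd.dvd_of_dvd_mul_right ((dvd_add_right hpx3).1 hsum)))

-- Geometrically: a section does not meet the singular point of a fibre `y² = x³` at infinity.
theorem coeff_six_ne_zero (hdeg : S.natDegree = 5 ∨ S.natDegree = 6) (h : (curve S).Equation x y)
    (hx : x.num.natDegree < x.denom.natDegree + 2) : S.coeff 6 ≠ 0 := by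
  have hS0 : S ≠ 0 := ne_zero_of_natDegree_gt (n := 4) (by omega)
  rcases hdeg with hdeg | hdeg
  · have hdegree : (S * x.denom ^ 3).natDegree = 5 + 3 * x.denom.natDegree := by
      rw [natDegree_mul hS0 (pow_ne_zero _ x.denom_ne_zero), natDegree_pow, hdeg]
    have hnum := two_mul_natDegree_num h
    rw [natDegree_add_eq_right_of_natDegree_lt (by rw [hdegree, natDegree_pow]; omega),
      hdegree] at hnum
    have hdenom := two_mul_natDegree_denom h
    omega
  · exact hdeg ▸ leadingCoeff_ne_zero.2 hS0

/-! ### The height attached to the minimal model -/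

/-- Coprime homogeneous coordinates `(p : q)` of the `x`-coordinate of a point, the point at
infinity having `x`-coordinate `(1 : 0)`. -/
noncomputable def xCoord : (curve S).Point → Fin 2 → K[X]
  | .zero => ![1, 0]
  | .some x _ _ => ![x.num, x.denom]

/-- The degree of the `x`-coordinate of a point `P`, the denominator having weight `2`. This is the
intersection-theoretic height of the section `P` of the minimal model of the elliptic surface. -/
noncomputable def weightedHeight (P : (curve S).Point) : ℕ :=
  weightedDegree (xCoord P)

theorem isCoprime_xCoord (P : (curve S).Point) : IsCoprime (xCoord P 0) (xCoord P 1) := by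
  rcases P with _ | ⟨x, _, _⟩
  · exact isCoprime_one_left
  · exact x.isCoprime_num_denom

theorem isUnimodular_xCoord (P : (curve S).Point) : IsUnimodular (xCoord P) :=
  isUnimodular_of_isCoprime (isCoprime_xCoord P)

theorem xCoord_ne_zero (P : (curve S).Point) : xCoord P ≠ 0 :=
  (isUnimodular_xCoord P).comp_ringHom_ne_zero (RingHom.id _)

theorem isCoprime_xCoord_zero (hS : Squarefree S) (P : (curve S).Point) :
    IsCoprime (xCoord P 0) S := by
  rcases P with _ | ⟨x, y, h⟩
  · exact isCoprime_one_left
  · exact isCoprime_num hS h.1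

theorem exists_comp_xCoord_eq_smul (P : (curve S).Point) :
    ∃ c : RatFunc K, algebraMap K[X] (RatFunc K) ∘ xCoord P = c • P.xRep := by
  rcases P with _ | ⟨x, y, h⟩
  · exact ⟨1, by ext i; fin_cases i <;> simp [xCoord, WeierstrassCurve.Affine.Point.xRep]⟩
  · refine ⟨algebraMap K[X] (RatFunc K) x.denom, ?_⟩
    have hx : algebraMap K[X] (RatFunc K) x.num = algebraMap K[X] (RatFunc K) x.denom * x := by
      rw [mul_comm, ← div_eq_iff (RatFunc.algebraMap_ne_zero x.denom_ne_zero), x.num_div_denom]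
    ext i
    fin_cases i <;> simp [xCoord, hx]

theorem exists_comp_symProd_xCoord_eq_smul (P Q : (curve S).Point) :
    ∃ c : RatFunc K, algebraMap K[X] (RatFunc K) ∘ symProd (xCoord P) (xCoord Q) =
      c • P.sym2x Q := by
  obtain ⟨a, ha⟩ := exists_comp_xCoord_eq_smul P
  obtain ⟨b, hb⟩ := exists_comp_xCoord_eq_smul Q
  exact ⟨a * b, by rw [comp_symProd, ha, hb, symProd_smul_smul]; rfl⟩

theorem exists_comp_addSubForms_xCoord_eq_smul (P Q : (curve S).Point) :
    ∃ c : RatFunc K, algebraMap K[X] (RatFunc K) ∘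
        addSubForms (mordellCurve S) (symProd (xCoord P) (xCoord Q)) =
      c • (P + Q).sym2x (P - Q) := by
  obtain ⟨a, ha⟩ := exists_comp_symProd_xCoord_eq_smul P Q
  obtain ⟨b, hb⟩ := exists_addSubForms_sym2x_eq_smul P Q
  refine ⟨a ^ 2 * b, ?_⟩
  rw [comp_addSubForms, map_mordellCurve, ha, addSubForms_smul, mul_smul, ← hb]
  rfl

theorem weightedHeight_zero : weightedHeight (0 : (curve S).Point) = 0 := by
  simp [weightedHeight, weightedDegree, Fin.univ_succ, twist, xCoord]

theorem weightedHeight_some (h : (curve S).Nonsingular x y) :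
    weightedHeight (.some x y h) = max x.num.natDegree (x.denom.natDegree + 2) := by
  simp [weightedHeight, weightedDegree, Fin.univ_succ, twist, xCoord,
    natDegree_X_pow_mul, x.denom_ne_zero]

theorem coeff_six_ne_zero_of_coeff_xCoord_eq_zero (hdeg : S.natDegree = 5 ∨ S.natDegree = 6)
    {P : (curve S).Point} (hP : (xCoord P 0).coeff (weightedHeight P) = 0) : S.coeff 6 ≠ 0 := by
  rcases P with _ | ⟨x, y, h⟩
  · rw [← WeierstrassCurve.Affine.Point.zero_def, weightedHeight_zero] at hP
    simp [xCoord] at hP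
  refine coeff_six_ne_zero hdeg h.1 (lt_of_not_ge fun hle => ?_)
  have hnum : x.num = 0 := by
    rw [weightedHeight_some, max_eq_left hle] at hP
    exact leadingCoeff_eq_zero.1 hP
  simp [hnum] at hle

theorem weightedHeight_parallelogram (h2 : (2 : K) ≠ 0) (h3 : (3 : K) ≠ 0)
    (hdeg : S.natDegree = 5 ∨ S.natDegree = 6) (hS : Squarefree S) (P Q : (curve S).Point) :
    weightedHeight (P + Q) + weightedHeight (P - Q) =
      2 * (weightedHeight P + weightedHeight Q) := by
  have hunit {n : ℕ} [n.AtLeastTwo] (hn : (ofNat(n) : K) ≠ 0) : IsUnit (ofNat(n) : K[X]) :=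
    map_ofNat (C : K →+* K[X]) n ▸ isUnit_C.2 hn.isUnit
  have hforms : IsUnimodular (addSubForms (mordellCurve S) (symProd (xCoord P) (xCoord Q))) :=
    .addSubForms_symProd (hunit h2) (hunit h3) (isUnimodular_xCoord P) (isUnimodular_xCoord Q)
      (isCoprime_xCoord_zero hS P)
  have hsym : IsUnimodular (symProd (xCoord (P + Q)) (xCoord (P - Q))) :=
    (isUnimodular_xCoord _).symProd (isUnimodular_xCoord _)
  obtain ⟨a, ha⟩ := exists_comp_addSubForms_xCoord_eq_smul P Q
  obtain ⟨b, hb⟩ := exists_comp_symProd_xCoord_eq_smul (P + Q) (P - Q)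
  have hdegree := hforms.weightedDegree_eq hsym
    (mul_eq_mul_of_comp_eq_smul (RatFunc.algebraMap_injective K) ha hb)
  rw [weightedDegree_symProd (xCoord_ne_zero _) (xCoord_ne_zero _),
    weightedDegree_addSubForms_symProd h2 h3 (by omega) (xCoord_ne_zero P) (xCoord_ne_zero Q)
      (coeff_six_ne_zero_of_coeff_xCoord_eq_zero hdeg)] at hdegree
  exact hdegree.symm

theorem even_weightedHeight (hS : S.natDegree ≤ 6) (P : (curve S).Point) :
    Even (weightedHeight P) := by
  rcases P with _ | ⟨x, y, h⟩
  · exact weightedHeight_zero (S := S) ▸ Even.zero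
  have hdenom := two_mul_natDegree_denom h.1
  rw [weightedHeight_some, Nat.even_iff]
  rcases le_or_gt x.num.natDegree (x.denom.natDegree + 2) with hle | hlt
  · omega
  · have hnum := two_mul_natDegree_num h.1
    have hlt3 : (S * x.denom ^ 3).natDegree < (x.num ^ 3).natDegree := by
      rw [natDegree_pow]
      exact (natDegree_mul_denom_pow_le hS).trans_lt (by omega)
    rw [natDegree_add_eq_left_of_natDegree_lt hlt3, natDegree_pow] at hnum
    omega

theorem two_le_weightedHeight {P : (curve S).Point} (hP : P ≠ 0) : 2 ≤ weightedHeight P := by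
  rcases P with _ | ⟨x, y, h⟩
  · exact absurd rfl hP
  · exact weightedHeight_some h ▸ le_max_of_le_right (Nat.le_add_left _ _)

theorem abs_weightedHeight_sub_naiveHeight_le (hS : S.natDegree ≤ 6) (P : (curve S).Point) :
    |(weightedHeight P : ℝ) - naiveHeight P| ≤ 2 := by
  rcases P with _ | ⟨x, y, h⟩
  · simp [← WeierstrassCurve.Affine.Point.zero_def, weightedHeight_zero, naiveHeight]
  have hdenom := two_mul_natDegree_denom h.1
  have hnum := two_mul_natDegree_num_le hS h.1
  have hx : ratDegree x ≤ weightedHeight (.some x y h) := by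
    rw [weightedHeight_some, ratDegree]; omega
  have hx' : weightedHeight (.some x y h) ≤ ratDegree x + 2 := by
    rw [weightedHeight_some, ratDegree]; omega
  have hy : 2 * ratDegree y ≤ 3 * weightedHeight (.some x y h) := by
    rw [weightedHeight_some, ratDegree]; omega
  rify at hx hx' hy
  have hle : max (ratDegree x : ℝ) (2 / 3 * ratDegree y) ≤ weightedHeight (.some x y h) :=
    max_le hx (by linarith)
  have hge := le_max_left (ratDegree x : ℝ) (2 / 3 * ratDegree y)
  rw [naiveHeight, abs_le]
  constructor <;> linarith

theorem exists_isMinimalSolution_of_weightedHeight_eq_two (hS : S.natDegree ≤ 6)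
    {P : (curve S).Point} (hP : weightedHeight P = 2) :
    ∃ x y : K[X], IsMinimalSolution S x y ∧
      ∃ h : (curve S).Nonsingular (algebraMap K[X] (RatFunc K) x) (algebraMap K[X] (RatFunc K) y),
        P = .some _ _ h := by
  rcases P with _ | ⟨x, y, h⟩
  · exact absurd (weightedHeight_zero.symm.trans hP) (by norm_num)
  rw [weightedHeight_some] at hP
  have hdenom := two_mul_natDegree_denom h.1
  have hnum := two_mul_natDegree_num_le hS h.1
  have hpoly (f : RatFunc K) (hf : f.denom.natDegree = 0) :
      ∃ p : K[X], f = algebraMap K[X] (RatFunc K) p := by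
    refine ⟨f.num, ?_⟩
    conv_lhs => rw [← f.num_div_denom, eq_one_of_monic_natDegree_zero f.monic_denom hf, map_one,
      div_one]
  obtain ⟨p, rfl⟩ := hpoly x (by omega)
  obtain ⟨q, rfl⟩ := hpoly y (by omega)
  rw [RatFunc.num_algebraMap] at hP hnum
  rw [RatFunc.num_algebraMap] at hnum
  refine ⟨p, q, ⟨by omega, by omega, RatFunc.algebraMap_injective K ?_⟩, h, rfl⟩
  simpa only [map_pow, map_add] using equation_curve_iff.1 h.1

theorem IsMinimalSolution.nonsingular (h2 : (2 : K) ≠ 0) (h3 : (3 : K) ≠ 0) (hS : S ≠ 0)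
    {x y : K[X]} (hxy : IsMinimalSolution S x y) :
    (curve S).Nonsingular (algebraMap K[X] (RatFunc K) x) (algebraMap K[X] (RatFunc K) y) := by
  refine (WeierstrassCurve.Affine.equation_iff_nonsingular_of_Δ_ne_zero
    (curve_Δ_ne_zero h2 h3 hS)).1 (equation_curve_iff.2 ?_)
  rw [← map_pow, hxy.equation, map_add, map_pow]

theorem IsMinimalSolution.weightedHeight_eq_two {x y : K[X]} (hxy : IsMinimalSolution S x y)
    (h : (curve S).Nonsingular (algebraMap K[X] (RatFunc K) x) (algebraMap K[X] (RatFunc K) y)) :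
    weightedHeight (.some _ _ h) = 2 := by
  simpa [weightedHeight_some] using hxy.degree_x

end Points

/-! ### Quadratic maps -/

section QuadraticMap

open Filter QuadraticMap Topology

variable {A M : Type*} [AddCommGroup A] [AddCommGroup M] [IsAddTorsionFree M]

theorem polar_add_left_of_parallelogram {f : A → M}
    (hf : ∀ a b, f (a + b) + f (a - b) = 2 • (f a + f b)) (a b c : A) :
    polar f (a + b) c = polar f a c + polar f b c := by
  have e₁ := hf (a + c) b
  have e₂ := hf a (b + c)
  have e₃ := hf (a - b) c
  rw [add_right_comm, add_sub_right_comm] at e₁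
  rw [← add_assoc, ← sub_sub] at e₂
  apply nsmul_right_injective two_ne_zero
  simp only [polar]
  linear_combination (norm := module) e₁ + e₂ - e₃ - 2 • hf a b

theorem exists_quadraticMap_of_parallelogram {f : A → M}
    (hf : ∀ a b, f (a + b) + f (a - b) = 2 • (f a + f b)) :
    ∃ Q : QuadraticMap ℤ A M, ∀ a, Q a = f a := by
  have h0 : f 0 = 0 := by
    have := hf 0 0
    rw [add_zero, sub_zero, two_nsmul, right_eq_add, ← two_nsmul] at this
    exact (nsmul_eq_zero_iff_right two_ne_zero).1 this
  have hself (a : A) : polar f a a = 2 • f a := by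
    have := hf a a
    rw [sub_self, h0, add_zero] at this
    rw [polar, this]
    module
  have hadd := polar_add_left_of_parallelogram hf
  have hsmul (n : ℤ) (a b : A) : polar f (n • a) b = n • polar f a b :=
    map_zsmul (AddMonoidHom.mk' (fun a => polar f a b) fun a a' => hadd a a' b) n a
  refine ⟨ofPolar f (fun n a => nsmul_right_injective two_ne_zero ?_) hadd hsmul, fun a => rfl⟩
  calc 2 • f (n • a) = polar f (n • a) (n • a) := (hself _).symm
    _ = n • n • 2 • f a := by rw [hsmul, polar_comm, hsmul, hself]
    _ = 2 • (n * n) • f a := by module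

theorem torsion_eq_bot_of_anisotropic {Q : QuadraticMap ℤ A M} (hQ : Q.Anisotropic) :
    AddCommGroup.torsion A = ⊥ := by
  refine eq_bot_iff.2 fun a ha => hQ a ?_
  obtain ⟨n, hn, hna⟩ := isOfFinAddOrder_iff_nsmul_eq_zero.1 ha
  have hQa := Q.map_smul n a
  rw [natCast_zsmul, hna, Q.map_zero] at hQa
  exact (smul_eq_zero.1 hQa.symm).resolve_left (by positivity)

theorem tendsto_div_four_pow_of_abs_sub_le {Q : QuadraticMap ℤ A ℝ} {h : A → ℝ} {C : ℝ}
    (hC : ∀ a, |Q a - h a| ≤ C) (a : A) :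
    Tendsto (fun n : ℕ => h ((2 ^ n : ℕ) • a) / 4 ^ n) atTop (𝓝 (Q a)) := by
  have hQ (n : ℕ) : Q ((2 ^ n : ℕ) • a) / 4 ^ n = Q a := by
    have := Q.map_smul (2 ^ n : ℕ) a
    rw [natCast_zsmul, ← Nat.cast_mul, ← mul_pow, natCast_zsmul, nsmul_eq_mul] at this
    rw [this]
    push_cast
    norm_num
  have hlim : Tendsto (fun n : ℕ => C / 4 ^ n) atTop (𝓝 0) :=
    tendsto_const_nhds.div_atTop (tendsto_pow_atTop_atTop_of_one_lt (by norm_num))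
  refine tendsto_iff_dist_tendsto_zero.2 (squeeze_zero (fun n => dist_nonneg) (fun n => ?_) hlim)
  have h4 : (0 : ℝ) < 4 ^ n := by positivity
  rw [dist_comm, Real.dist_eq, ← hQ n, ← sub_div, abs_div, abs_of_pos h4]
  exact div_le_div_of_nonneg_right (hC _) h4.le

end QuadraticMap

/-! ### The canonical height -/

section CanonicalHeight

variable {K : Type*} [Field K] {S : K[X]}

theorem IsCanonicalHeight.eq_canonicalHeight {g : (curve S).Point → ℝ} (hg : IsCanonicalHeight g) :
    g = canonicalHeight := by
  obtain ⟨⟨Q, hQ⟩, C, hC⟩ := hg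
  obtain rfl : Q = g := funext hQ
  exact funext fun P => (tendsto_div_four_pow_of_abs_sub_le hC P).limUnder_eq.symm

theorem IsCanonicalHeight.torsion_eq_bot {g : (curve S).Point → ℝ} (hg : IsCanonicalHeight g)
    (hpos : ∀ P, P ≠ 0 → 0 < g P) : AddCommGroup.torsion (curve S).Point = ⊥ := by
  obtain ⟨⟨Q, hQ⟩, -⟩ := hg
  have hQpos : Q.PosDef := fun P hP => (hpos P hP).trans_eq (hQ P).symm
  exact torsion_eq_bot_of_anisotropic hQpos.anisotropic

theorem isCanonicalHeight_weightedHeight (h2 : (2 : K) ≠ 0) (h3 : (3 : K) ≠ 0)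
    (hdeg : S.natDegree = 5 ∨ S.natDegree = 6) (hS : Squarefree S) :
    IsCanonicalHeight fun P : (curve S).Point => (weightedHeight P : ℝ) where
  quadratic := exists_quadraticMap_of_parallelogram fun P Q => by
    rw [nsmul_eq_mul]
    exact_mod_cast weightedHeight_parallelogram h2 h3 hdeg hS P Q
  bounded := ⟨2, abs_weightedHeight_sub_naiveHeight_le (by omega)⟩

end CanonicalHeight

theorem mainTheorem7_general {K : Type*} [Field K] (h2 : (2 : K) ≠ 0) (h3 : (3 : K) ≠ 0)
    (S : K[X]) (hdeg : S.natDegree = 5 ∨ S.natDegree = 6) (hS : Squarefree S) :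
    (IsCanonicalHeight (canonicalHeight : (curve S).Point → ℝ) ∧
      ∀ g : (curve S).Point → ℝ, IsCanonicalHeight g → g = canonicalHeight) ∧
    (∀ P : (curve S).Point, (∃ m : ℤ, Even m ∧ canonicalHeight P = m) ∧
      (P ≠ 0 → 0 < canonicalHeight P)) ∧
    ((∀ P : (curve S).Point, canonicalHeight P = 2 →
        ∃ x y : K[X], IsMinimalSolution S x y ∧
          ∃ h : (curve S).Nonsingular (algebraMap K[X] (RatFunc K) x)
              (algebraMap K[X] (RatFunc K) y),
            P = .some _ _ h) ∧
      (∀ x y : K[X], IsMinimalSolution S x y →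
        ∃ h : (curve S).Nonsingular (algebraMap K[X] (RatFunc K) x)
            (algebraMap K[X] (RatFunc K) y),
          canonicalHeight (.some _ _ h) = 2)) ∧
    AddCommGroup.torsion (curve S).Point = ⊥ := by
  have hcan := isCanonicalHeight_weightedHeight h2 h3 hdeg hS
  have hS6 : S.natDegree ≤ 6 := by omega
  have hpos (P : (curve S).Point) (hP : P ≠ 0) : (0 : ℝ) < weightedHeight P :=
    Nat.cast_pos.2 (two_pos.trans_le (two_le_weightedHeight hP))
  rw [← hcan.eq_canonicalHeight]
  refine ⟨⟨hcan, fun g hg => hg.eq_canonicalHeight.trans hcan.eq_canonicalHeight.symm⟩,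
    fun P => ⟨⟨weightedHeight P, ?_, rfl⟩, hpos P⟩, ⟨fun P hP => ?_, fun x y hxy => ?_⟩,
    hcan.torsion_eq_bot hpos⟩
  · exact_mod_cast even_weightedHeight hS6 P
  · exact exists_isMinimalSolution_of_weightedHeight_eq_two hS6 (Nat.cast_injective (R := ℝ) hP)
  · exact ⟨hxy.nonsingular h2 h3 hS.ne_zero, congrArg Nat.cast (hxy.weightedHeight_eq_two _)⟩

end SexticSurface

open SexticSurface in
theorem mainTheorem7 {k K : Type*} [Field k] [Field K] [Algebra k K] [IsAlgClosure k K]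
    (h2 : (2 : k) ≠ 0) (h3 : (3 : k) ≠ 0)
    (S : k[X]) (hdeg : S.natDegree = 5 ∨ S.natDegree = 6) (hS : S.Separable) :
    -- the canonical height on the group of `K(t)`-points exists and is unique
    (IsCanonicalHeight (canonicalHeight : (curve (S.map (algebraMap k K))).Point → ℝ) ∧
      ∀ g : (curve (S.map (algebraMap k K))).Point → ℝ, IsCanonicalHeight g → g = canonicalHeight) ∧
    -- (i)
    (∀ P : (curve (S.map (algebraMap k K))).Point, (∃ m : ℤ, Even m ∧ canonicalHeight P = m) ∧
      (P ≠ 0 → 0 < canonicalHeight P)) ∧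
    -- (ii)
    ((∀ P : (curve (S.map (algebraMap k K))).Point, canonicalHeight P = 2 →
        ∃ x y : K[X], IsMinimalSolution (S.map (algebraMap k K)) x y ∧
          ∃ h : (curve (S.map (algebraMap k K))).Nonsingular (algebraMap K[X] (RatFunc K) x)
              (algebraMap K[X] (RatFunc K) y),
            P = .some _ _ h) ∧
      (∀ x y : K[X], IsMinimalSolution (S.map (algebraMap k K)) x y →
        ∃ h : (curve (S.map (algebraMap k K))).Nonsingular (algebraMap K[X] (RatFunc K) x)
            (algebraMap K[X] (RatFunc K) y),
          canonicalHeight (.some _ _ h) = 2)) ∧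
    -- (iii)
    AddCommGroup.torsion (curve (S.map (algebraMap k K))).Point = ⊥ := by
  have hne {n : ℕ} [n.AtLeastTwo] (hn : (ofNat(n) : k) ≠ 0) : (ofNat(n) : K) ≠ 0 := by
    simpa only [map_ofNat] using (map_ne_zero (algebraMap k K)).2 hn
  exact mainTheorem7_general (hne h2) (hne h3) _ (by rwa [natDegree_map]) hS.map.squarefree
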